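/- Let $d:\mathbb N\to\mathbb R$ satisfy $d(n)=n^{o(1)}$, in the sense that there is a function $g$ with $g(n)\to 0$ as $n\to\infty$ and $0\le d(n)\le n^{g(n)}$ for all sufficiently large $n$. Let $G(n,d(n)/n)$ be the random graph on $n$ labelled vertices in which each edge is present independently with probability $d(n)/n$. Then $G(n,d(n)/n)$ has a.a.s. locally bounded treewidth: there is a function $f:\mathbb N\to\mathbb N$ (which may depend on the function $d$, but not on $n$) such that, with probability tending to $1$ as $n\to\infty$, for all $r\ge 0$ simultaneously, every subgraph of $G(n,d(n)/n)$ of radius at most $r$ has treewidth at most $f(r)$. Consequently, $G(n,d(n)/n)$ is a.a.s. nowhere dense: there is a function $f':\mathbb N\to\mathbb N$ such that, with probability tending to $1$ as $n\to\infty$, for all $r\ge 0$ simultaneously, every $r$-shallow topological minor of $G(n,d(n)/n)$ has clique number less than $f'(r)$. Here a graph $M$ is an $r$-shallow topological minor of $G$ if some subgraph of $G$ is isomorphic to a graph obtained from $M$ by replacing its edges by internally disjoint paths of length at most $2r+1$. -/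

import Mathlib

open Filter Topology MeasureTheory

universe u v

namespace RandomSparse

/-- A tree decomposition of a graph `G`. The field `bag` assigns to each node of a finite tree a
set of vertices of `G`. -/
structure TreeDecomposition {V : Type u} (G : SimpleGraph V) where
  /-- the nodes of the tree -/
  Node : Type u
  finite_node : Finite Node
  /-- the tree -/
  tree : SimpleGraph Node
  isTree : tree.IsTree
  /-- the bags -/
  bag : Node → Set V
  /-- every vertex lies in a bag -/
  vertex_mem : ∀ x : V, ∃ t, x ∈ bag t
  /-- both ends of every edge lie in a common bag -/
  edge_mem : ∀ x y : V, G.Adj x y → ∃ t, x ∈ bag t ∧ y ∈ bag t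
  /-- the nodes whose bags contain a given vertex induce a connected subgraph of the tree -/
  connected : ∀ x : V, (tree.induce {t | x ∈ bag t}).Preconnected

/-- The width of a tree decomposition: the largest size of a bag, minus one. -/
noncomputable def TreeDecomposition.width {V : Type u} {G : SimpleGraph V}
    (D : TreeDecomposition G) : ℕ∞ :=
  (⨆ t : D.Node, (D.bag t).encard) - 1

/-- The treewidth of a graph: the smallest width of a tree decomposition. -/
noncomputable def treewidth {V : Type u} (G : SimpleGraph V) : ℕ∞ :=
  ⨅ D : TreeDecomposition G, D.width

/-- `M` is an `r`-shallow topological minor of `G`: the vertices of `M` are mapped injectively to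
vertices of `G` (the nails), and the edges of `M` to paths of length at most `2 * r + 1` between the
corresponding nails, such that a path meets no nails other than its own ends, and the paths of
distinct edges have no vertices in common except nails. -/
def IsShallowTopologicalMinor {W : Type u} {V : Type v} (r : ℕ) (M : SimpleGraph W)
    (G : SimpleGraph V) : Prop :=
  ∃ (nail : W ↪ V) (path : ∀ a b : W, M.Adj a b → G.Walk (nail a) (nail b)),
    (∀ (a b : W) (h : M.Adj a b), (path a b h).IsPath ∧ (path a b h).length ≤ 2 * r + 1) ∧
    -- both orientations of an edge are given the same path
    (∀ (a b : W) (h : M.Adj a b), path b a h.symm = (path a b h).reverse) ∧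
    (∀ (a b : W) (h : M.Adj a b) (c : W), nail c ∈ (path a b h).support → c = a ∨ c = b) ∧
    (∀ (a b : W) (h : M.Adj a b) (a' b' : W) (h' : M.Adj a' b'), s(a, b) ≠ s(a', b') →
      ∀ x : V, x ∈ (path a b h).support → x ∈ (path a' b' h').support → x ∈ Set.range nail)

/-- The largest clique number of an `r`-shallow topological minor of `G`. (Up to isomorphism, every
finite graph has vertex set `Fin m` for some `m`.) -/
noncomputable def shallowCliqueNum {V : Type u} (r : ℕ) (G : SimpleGraph V) : ℕ∞ :=
  ⨆ (m : ℕ) (M : SimpleGraph (Fin m)) (_ : IsShallowTopologicalMinor r M G), (M.cliqueNum : ℕ∞)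

/-- A class of finite graphs, given by its members on the vertex sets `Fin n`. -/
abbrev GraphClass : Type := (n : ℕ) → Set (SimpleGraph (Fin n))

/-- A graph class has locally bounded treewidth if, for some function `f`, every subgraph of radius
at most `r` of a graph in the class has treewidth at most `f r`, for all `r`. (The radius of a
disconnected graph, and that of the graph without vertices, is `⊤`.) -/
def LocallyBoundedTreewidth (𝒢 : GraphClass) : Prop :=
  ∃ f : ℕ → ℕ, ∀ r n : ℕ, ∀ G ∈ 𝒢 n, ∀ H : G.Subgraph,
    H.coe.radius ≤ (r : ℕ∞) → treewidth H.coe ≤ (f r : ℕ∞)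

/-- A graph class is nowhere dense if, for some function `f`, the `r`-shallow topological minors of
the graphs in the class have clique number less than `f r`, for all `r`. -/
def NowhereDense (𝒢 : GraphClass) : Prop :=
  ∃ f : ℕ → ℕ, ∀ r n : ℕ, ∀ G ∈ 𝒢 n, shallowCliqueNum r G < (f r : ℕ∞)

/-- `d(n) = n ^ o(1)`, as an upper bound on a nonnegative function (for large `n`). -/
def IsSubpolynomial (d : ℕ → ℝ) : Prop :=
  ∃ g : ℕ → ℝ, Tendsto g atTop (𝓝 0) ∧ ∀ᶠ n : ℕ in atTop, 0 ≤ d n ∧ d n ≤ (n : ℝ) ^ g n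

/-- The law of the random graph `G(n, d / n)` on the vertex set `Fin n`, in which the edges are
present independently with probability `d / n` (truncated to `[0, 1]`). -/
noncomputable def erdosRenyi (n : ℕ) (d : ℝ) : Measure (SimpleGraph (Fin n)) :=
  SimpleGraph.binomialRandom (Fin n) (Set.projIcc (0 : ℝ) 1 zero_le_one (d / n))

/-- The random graphs `G(n, d(n) / n)` have a property `P` of graph classes asymptotically almost
surely: they belong to some class with property `P` with probability tending to one. -/
def AsymptoticallyAlmostSurely (d : ℕ → ℝ) (P : GraphClass → Prop) : Prop :=
  ∃ 𝒢 : GraphClass, P 𝒢 ∧ Tendsto (fun n : ℕ => erdosRenyi n (d n) (𝒢 n)) atTop (𝓝 1)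

end RandomSparse

/-!
Call a graph sparse up to `K` if any `k ≤ K` of its vertices span at most `k` edges. The expected
number of sets of `k` vertices of `G(n, d / n)` that span more than `k` edges is at most
`C_k n ^ k (d / n) ^ (k + 1) = C_k d ^ (k + 1) / n`, which tends to zero if `d = n ^ o(1)`. So for
every fixed `K` the random graph is sparse up to `K` a.a.s., and a diagonal argument
(`exists_sparse_class`) gives `κ n → ∞` such that it is sparse up to `κ n` a.a.s. The class of these
graphs serves for both claims, because the remaining arguments are deterministic:

* In a connected graph of radius at most `r`, take a breadth-first search tree from a centre. Two
  edges outside it, together with the tree paths from their ends to the root, would form a graph on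
  at most `4 r + 1` vertices with more edges than vertices. So if the graph is sparse up to
  `4 r + 1`, then it is a tree plus at most one edge, and its treewidth is at most two
  (`SparseUpTo.treewidth_le_two`).
* A subdivision of `K₄` in which every edge is replaced by a path of length at most `2 r + 1` has at
  most `12 r + 4` vertices, and two more edges than vertices. So in a graph that is sparse up to
  `12 r + 4` the `r`-shallow topological minors contain no `K₄`
  (`SparseUpTo.cliqueFree_four`).

For given `r` this settles all graphs of the class with `κ n ≥ 12 r + 4`. The other ones have
boundedly many vertices, which bounds their treewidth and their clique numbers.
-/

namespace RandomSparse

/-! ### Sparsity of random graphs -/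

/-- A graph is sparse up to `K` if every set of at most `K` vertices spans at most as many edges as
it has elements. -/
def SparseUpTo {V : Type*} (K : ℕ) (G : SimpleGraph V) : Prop :=
  ∀ (S : Finset V) (T : Finset (Sym2 V)), S.card ≤ K → T ⊆ S.sym2 → (T : Set (Sym2 V)) ⊆ G.edgeSet →
    T.card ≤ S.card

lemma SparseUpTo.mono {V : Type*} {K L : ℕ} {G : SimpleGraph V} (h : SparseUpTo L G) (hKL : K ≤ L) :
    SparseUpTo K G :=
  fun S T hS => h S T (hS.trans hKL)

open unitInterval ProbabilityTheory in
lemma binomialRandom_subset_edgeSet_le {V : Type*} [Countable V] (p : I) (T : Finset (Sym2 V)) :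
    SimpleGraph.binomialRandom V p {G | (T : Set (Sym2 V)) ⊆ G.edgeSet} ≤
      (toNNReal p : ENNReal) ^ T.card := by
  rw [SimpleGraph.binomialRandom_apply']
  calc _ ≤ setBernoulli (Sym2.diagSetᶜ) p {s : Set (Sym2 V) | (T : Set (Sym2 V)) ⊆ s} := by
        apply measure_mono
        rintro _ ⟨G, hG, rfl⟩
        exact hG
    _ = Measure.infinitePi (fun i : Sym2 V ↦ toNNReal p • Measure.dirac (i ∈ Sym2.diagSetᶜ) +
          toNNReal (σ p) • Measure.dirac False) (Set.pi T fun _ => {True}) := by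
        rw [setBernoulli_apply']
        congr 1
        ext f
        simp [Set.subset_def, Set.pi]
    _ ≤ _ := by
        rw [Measure.infinitePi_pi _ (fun _ _ => .of_discrete)]
        refine (Finset.prod_le_pow_card _ _ (toNNReal p : ENNReal) ?_)
        intro i _
        simp only [Measure.coe_add, Pi.add_apply, Measure.smul_apply, Measure.dirac_apply]
        by_cases h : i.IsDiag <;> simp [h, ENNReal.smul_def]

open unitInterval in
/-- The union bound, over all choices of `k` vertices and `k + 1` pairs among them. -/
lemma binomialRandom_not_sparseUpTo_le {V : Type*} [Fintype V] (p : I) (K : ℕ) :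
    SimpleGraph.binomialRandom V p {G | ¬ SparseUpTo K G} ≤
      ∑ k ∈ Finset.range (K + 1),
        (Fintype.card V : ENNReal) ^ k * 2 ^ ((k + 1).choose 2) * (toNNReal p : ENNReal) ^ (k + 1) := by
  classical
  calc _ ≤ SimpleGraph.binomialRandom V p (⋃ k ∈ Finset.range (K + 1),
          ⋃ S ∈ Finset.powersetCard k (Finset.univ : Finset V),
          ⋃ T ∈ Finset.powersetCard (k + 1) S.sym2, {G | (T : Set (Sym2 V)) ⊆ G.edgeSet}) := by
        apply measure_mono
        intro G hG
        simp only [SparseUpTo, Set.mem_ofPred_eq, not_forall, not_le] at hG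
        obtain ⟨S, T, hS, hTS, hTG, hc⟩ := hG
        obtain ⟨T', hT', hc'⟩ := Finset.exists_subset_card_eq hc
        simp only [Set.mem_iUnion]
        refine ⟨S.card, by simpa [Nat.lt_succ_iff] using hS, S, by simp, T', ?_, ?_⟩
        · exact Finset.mem_powersetCard.2 ⟨hT'.trans hTS, hc'⟩
        · exact subset_trans (by exact_mod_cast hT') hTG
    _ ≤ ∑ k ∈ Finset.range (K + 1), ∑ S ∈ Finset.powersetCard k (Finset.univ : Finset V),
          ∑ T ∈ Finset.powersetCard (k + 1) S.sym2, (toNNReal p : ENNReal) ^ (k + 1) := by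
        refine (measure_biUnion_finset_le _ _).trans (Finset.sum_le_sum fun k _ => ?_)
        refine (measure_biUnion_finset_le _ _).trans (Finset.sum_le_sum fun S _ => ?_)
        refine (measure_biUnion_finset_le _ _).trans (Finset.sum_le_sum fun T hT => ?_)
        rw [← (Finset.mem_powersetCard.1 hT).2]
        exact binomialRandom_subset_edgeSet_le p T
    _ ≤ _ := by
        refine Finset.sum_le_sum fun k _ => ?_
        calc _ ≤ ∑ S ∈ Finset.powersetCard k (Finset.univ : Finset V),
              2 ^ ((k + 1).choose 2) * (toNNReal p : ENNReal) ^ (k + 1) := by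
              refine Finset.sum_le_sum fun S hS => ?_
              rw [Finset.sum_const, nsmul_eq_mul]
              gcongr
              rw [Finset.card_powersetCard, Finset.card_sym2, (Finset.mem_powersetCard.1 hS).2]
              exact_mod_cast Nat.choose_le_two_pow _ _
          _ ≤ _ := by
              rw [Finset.sum_const, nsmul_eq_mul, mul_assoc]
              gcongr
              rw [Finset.card_powersetCard, Finset.card_univ]
              exact_mod_cast Nat.choose_le_pow _ _

/-- The term for `k` in the union bound is at most `C * d ^ (k + 1) / n`, and
`d ^ (k + 1) ≤ n ^ (1 / 2)` for large `n`. -/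
lemma tendsto_mul_pow_projIcc {d : ℕ → ℝ} (hd : IsSubpolynomial d) (k : ℕ) (C : ENNReal)
    (hC : C ≠ ⊤) :
    Tendsto (fun n : ℕ => (n : ENNReal) ^ k * C * (unitInterval.toNNReal
      (Set.projIcc (0 : ℝ) 1 zero_le_one (d n / n)) : ENNReal) ^ (k + 1)) atTop (𝓝 0) := by
  obtain ⟨g, hg, hdg⟩ := hd
  have hg' : ∀ᶠ n in atTop, g n * (k + 1 : ℕ) ≤ 1 / 2 := by
    have := hg.mul_const ((k + 1 : ℕ) : ℝ)
    rw [zero_mul] at this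
    exact this.eventually_le_const (by norm_num)
  have hlim : Tendsto (fun n : ℕ => C * ENNReal.ofReal ((n : ℝ) ^ (-(1 / 2) : ℝ))) atTop (𝓝 0) := by
    have h1 : Tendsto (fun n : ℕ => (n : ℝ) ^ (-(1 / 2) : ℝ)) atTop (𝓝 0) :=
      (tendsto_rpow_neg_atTop (by norm_num)).comp tendsto_natCast_atTop_atTop
    have h2 := ENNReal.tendsto_ofReal h1
    rw [ENNReal.ofReal_zero] at h2
    simpa using ENNReal.Tendsto.const_mul h2 (Or.inr hC)
  refine tendsto_of_tendsto_of_tendsto_of_le_of_le' tendsto_const_nhds hlim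
    (Eventually.of_forall fun _ => zero_le) ?_
  filter_upwards [hdg, hg', eventually_ge_atTop 1] with n hn hgn hn1
  have hn0 : (0 : ℝ) < n := by exact_mod_cast hn1
  have hn1' : (1 : ℝ) ≤ n := by exact_mod_cast hn1
  have hp : (unitInterval.toNNReal (Set.projIcc (0 : ℝ) 1 zero_le_one (d n / n)) : ENNReal) ≤
      ENNReal.ofReal (d n / n) := by
    rw [← ENNReal.ofReal_coe_nnreal]
    apply ENNReal.ofReal_le_ofReal
    simp only [unitInterval.coe_toNNReal, Set.coe_projIcc]
    exact max_le (div_nonneg hn.1 hn0.le) (min_le_right _ _)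
  have key : (n : ℝ) ^ k * (d n / n) ^ (k + 1) ≤ (n : ℝ) ^ (-(1 / 2) : ℝ) := by
    have h1 : (n : ℝ) ^ k * (d n / n) ^ (k + 1) = d n ^ (k + 1) * (n : ℝ)⁻¹ := by
      rw [div_pow, pow_succ (n : ℝ)]
      field_simp
    have h2 : d n ^ (k + 1) ≤ (n : ℝ) ^ (1 / 2 : ℝ) := by
      calc d n ^ (k + 1) ≤ ((n : ℝ) ^ g n) ^ (k + 1) := pow_le_pow_left₀ hn.1 hn.2 _
        _ = (n : ℝ) ^ (g n * (k + 1 : ℕ)) := by rw [Real.rpow_mul hn0.le, Real.rpow_natCast]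
        _ ≤ _ := Real.rpow_le_rpow_of_exponent_le hn1' hgn
    rw [h1]
    calc _ ≤ (n : ℝ) ^ (1 / 2 : ℝ) * (n : ℝ)⁻¹ := by gcongr
      _ = _ := by
        rw [← Real.rpow_neg_one, ← Real.rpow_add hn0]
        norm_num
  calc _ ≤ (n : ENNReal) ^ k * C * ENNReal.ofReal (d n / n) ^ (k + 1) := by gcongr
    _ = C * ENNReal.ofReal ((n : ℝ) ^ k * (d n / n) ^ (k + 1)) := by
        rw [ENNReal.ofReal_mul (by positivity), ENNReal.ofReal_pow hn0.le, ENNReal.ofReal_natCast,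
          ENNReal.ofReal_pow (div_nonneg hn.1 hn0.le)]
        ring
    _ ≤ _ := by gcongr

lemma tendsto_erdosRenyi_not_sparseUpTo {d : ℕ → ℝ} (hd : IsSubpolynomial d) (K : ℕ) :
    Tendsto (fun n : ℕ => erdosRenyi n (d n) {G | ¬ SparseUpTo K G}) atTop (𝓝 0) := by
  have h : Tendsto (fun n : ℕ => ∑ k ∈ Finset.range (K + 1),
      (n : ENNReal) ^ k * 2 ^ ((k + 1).choose 2) * (unitInterval.toNNReal
        (Set.projIcc (0 : ℝ) 1 zero_le_one (d n / n)) : ENNReal) ^ (k + 1)) atTop (𝓝 0) := by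
    simpa only [Finset.sum_const_zero] using tendsto_finsetSum (Finset.range (K + 1))
      fun k _ => tendsto_mul_pow_projIcc hd k (2 ^ ((k + 1).choose 2)) (by finiteness)
  refine tendsto_of_tendsto_of_tendsto_of_le_of_le tendsto_const_nhds h (fun _ => zero_le) ?_
  intro n
  have := binomialRandom_not_sparseUpTo_le (V := Fin n)
    (Set.projIcc (0 : ℝ) 1 zero_le_one (d n / n)) K
  rwa [Fintype.card_fin] at this

/-- If `q K n → 0` for every fixed `K`, then also for some `K = κ n` that grows with `n`: take the
largest `K ≤ n` with `q K n ≤ 1 / (K + 1)`. -/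
lemma exists_tendsto_atTop_diagonal (q : ℕ → ℕ → ENNReal) (hq1 : ∀ K n, q K n ≤ 1)
    (hq : ∀ K, Tendsto (q K) atTop (𝓝 0)) :
    ∃ κ : ℕ → ℕ, Tendsto κ atTop atTop ∧ Tendsto (fun n => q (κ n) n) atTop (𝓝 0) := by
  classical
  let P : ℕ → ℕ → Prop := fun n K => q K n ≤ ((K : ENNReal) + 1)⁻¹
  let κ : ℕ → ℕ := fun n => Nat.findGreatest (P n) n
  have hκ : Tendsto κ atTop atTop := by
    refine tendsto_atTop.2 fun K => ?_
    have hK : ∀ᶠ n in atTop, q K n ≤ ((K : ENNReal) + 1)⁻¹ :=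
      (hq K).eventually_le_const (ENNReal.inv_pos.2 (by finiteness))
    filter_upwards [hK, eventually_ge_atTop K] with n hn hKn
    exact Nat.le_findGreatest hKn hn
  refine ⟨κ, hκ, ?_⟩
  have hlim : Tendsto (fun n => ((κ n : ENNReal) + 1)⁻¹) atTop (𝓝 0) := by
    have := (tendsto_add_atTop_iff_nat (f := fun n : ℕ => (n : ENNReal)⁻¹) 1).2
      ENNReal.tendsto_inv_nat_nhds_zero
    simpa [Function.comp_def] using this.comp hκ
  refine tendsto_of_tendsto_of_tendsto_of_le_of_le tendsto_const_nhds hlim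
    (fun _ => zero_le) fun n => ?_
  exact Nat.findGreatest_spec (P := P n) (Nat.zero_le n) (by simpa [P] using hq1 0 n)

lemma measurableSet_of_finite {V : Type*} [Finite V] (A : Set (SimpleGraph V)) : MeasurableSet A := by
  rw [← SimpleGraph.measurableEmbedding_edgeSet.measurableSet_image]
  exact (Set.toFinite _).measurableSet

/-- The random graphs are a.a.s. sparse up to some `κ n` that tends to infinity with `n`. -/
lemma exists_sparse_class {d : ℕ → ℝ} (hd : IsSubpolynomial d) :
    ∃ κ : ℕ → ℕ, Tendsto κ atTop atTop ∧
      Tendsto (fun n : ℕ => erdosRenyi n (d n) {G | SparseUpTo (κ n) G}) atTop (𝓝 1) := by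
  have hprob : ∀ n, IsProbabilityMeasure (erdosRenyi n (d n)) := fun n => by
    unfold erdosRenyi; infer_instance
  obtain ⟨κ, hκ, h⟩ := exists_tendsto_atTop_diagonal
    (fun K n => erdosRenyi n (d n) {G | ¬ SparseUpTo K G}) (fun K n => prob_le_one)
    (tendsto_erdosRenyi_not_sparseUpTo hd)
  refine ⟨κ, hκ, ?_⟩
  have h1 : ∀ n, erdosRenyi n (d n) {G | SparseUpTo (κ n) G} =
      1 - erdosRenyi n (d n) {G | ¬ SparseUpTo (κ n) G} := fun n => by
    have := prob_compl_eq_one_sub (μ := erdosRenyi n (d n)) (s := {G | ¬ SparseUpTo (κ n) G})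
      (measurableSet_of_finite _)
    rw [← this]
    congr 1
    ext G
    simp
  simp only [h1]
  simpa using ENNReal.Tendsto.sub (tendsto_const_nhds (x := (1 : ENNReal))) h (by simp)

/-! ### Treewidth of sparse graphs of small radius -/

/-- The graph joining every vertex to its parent, for a parent function `par`. -/
def parentGraph {V : Type u} (par : V → V) : SimpleGraph V :=
  SimpleGraph.fromRel fun x y => par x = y

lemma parentGraph_adj {V : Type u} {par : V → V} {x y : V} :
    (parentGraph par).Adj x y ↔ x ≠ y ∧ (par x = y ∨ par y = x) :=
  SimpleGraph.fromRel_adj _ _ _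

section Parent

variable {V : Type u} {par : V → V} {h : V → ℕ} {v : V}

lemma parentGraph_connected (hv : ∀ x, x ≠ v → h (par x) < h x) :
    (parentGraph par).Connected := by
  have key : ∀ k x, h x ≤ k → (parentGraph par).Reachable x v := by
    intro k
    induction k with
    | zero =>
      intro x hx
      by_cases hxv : x = v
      · rw [hxv]
      · have := hv x hxv
        omega
    | succ k ih =>
      intro x hx
      by_cases hxv : x = v
      · rw [hxv]
      · have := hv x hxv
        have hadj : (parentGraph par).Adj x (par x) :=
          parentGraph_adj.2 ⟨fun e => by rw [← e] at this; omega, Or.inl rfl⟩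
        exact hadj.reachable.trans (ih _ (by omega))
  have : Nonempty V := ⟨v⟩
  exact ⟨fun x y => (key _ x le_rfl).trans (key _ y le_rfl).symm⟩

lemma parentGraph_isTree [Finite V] (hpv : par v = v) (hv : ∀ x, x ≠ v → h (par x) < h x) :
    (parentGraph par).IsTree := by
  classical
  have := Fintype.ofFinite V
  have hc := parentGraph_connected hv
  rw [SimpleGraph.isTree_iff_connected_and_card]
  refine ⟨hc, le_antisymm ?_ hc.card_vert_le_card_edgeSet_add_one⟩
  -- every edge joins a vertex other than the root to its parent
  have hsub : (parentGraph par).edgeSet ⊆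
      ((Finset.univ.erase v).image fun x => s(x, par x) : Finset (Sym2 V)) := by
    intro e he
    induction e with
    | _ x y =>
      obtain ⟨hne, hxy | hxy⟩ := parentGraph_adj.1 ((SimpleGraph.mem_edgeSet _).1 he)
      · refine Finset.mem_coe.2 (Finset.mem_image.2 ⟨x, ?_, by rw [hxy]⟩)
        simp only [Finset.mem_erase, Finset.mem_univ, and_true]
        rintro rfl
        exact hne (hpv.symm.trans hxy)
      · refine Finset.mem_coe.2 (Finset.mem_image.2 ⟨y, ?_, by rw [hxy, Sym2.eq_swap]⟩)
        simp only [Finset.mem_erase, Finset.mem_univ, and_true]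
        rintro rfl
        exact hne (hxy.symm.trans hpv)
  have h1 : Nat.card (parentGraph par).edgeSet ≤ Fintype.card V - 1 := by
    rw [Nat.card_coe_set_eq]
    refine (Set.ncard_le_ncard hsub).trans ?_
    rw [Set.ncard_coe_finset]
    refine Finset.card_image_le.trans ?_
    rw [Finset.card_erase_of_mem (Finset.mem_univ v), Finset.card_univ]
  have h2 : 0 < Fintype.card V := Fintype.card_pos_iff.2 ⟨v⟩
  rw [Nat.card_eq_fintype_card (α := V)]
  omega

/-- A tree plus edges at a single vertex `a` has treewidth at most two: the bag of a node `t` of the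
tree consists of `t`, its parent, and `a`. -/
lemma treewidth_le_two_of_parent [Finite V] {G : SimpleGraph V} (hpv : par v = v)
    (hv : ∀ x, x ≠ v → h (par x) < h x) (a : V)
    (ha : ∀ x y, G.Adj x y → (parentGraph par).Adj x y ∨ x = a ∨ y = a) :
    treewidth G ≤ 2 := by
  have hT := parentGraph_isTree hpv hv
  let D : TreeDecomposition G :=
    { Node := V
      finite_node := inferInstance
      tree := parentGraph par
      isTree := hT
      bag := fun t => {t, par t, a}
      vertex_mem := fun x => ⟨x, by simp⟩
      edge_mem := by
        intro x y hxy
        obtain hp | rfl | rfl := ha x y hxy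
        · obtain ⟨-, hp | hp⟩ := parentGraph_adj.1 hp
          · exact ⟨x, by simp, by simp [hp]⟩
          · exact ⟨y, by simp [hp], by simp⟩
        · exact ⟨y, by simp, by simp⟩
        · exact ⟨x, by simp, by simp⟩
      connected := by
        intro x
        by_cases hxa : x = a
        · have : {t | x ∈ ({t, par t, a} : Set V)} = Set.univ := by
            ext t; simp [hxa]
          rw [this]
          exact ((SimpleGraph.induceUnivIso _).connected_iff.2 hT.1).preconnected
        -- otherwise `x` lies in its own bag and in those of its children
        have key : ∀ t : {t | x ∈ ({t, par t, a} : Set V)},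
            ((parentGraph par).induce {t | x ∈ ({t, par t, a} : Set V)}).Reachable t
              ⟨x, by simp⟩ := by
          rintro ⟨t, ht⟩
          by_cases htx : t = x
          · subst htx; rfl
          · refine SimpleGraph.Adj.reachable ?_
            have ht' : x = t ∨ x = par t ∨ x = a := ht
            have hpt : par t = x := by grind
            exact parentGraph_adj.2 ⟨htx, Or.inl hpt⟩
        exact fun s t => (key s).trans (key t).symm }
  refine (iInf_le _ D).trans ?_
  refine tsub_le_iff_right.2 (iSup_le fun t => ?_)
  change ({t, par t, a} : Set V).encard ≤ 2 + 1
  refine (Set.encard_insert_le _ _).trans ?_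
  gcongr
  refine (Set.encard_insert_le _ _).trans ?_
  rw [Set.encard_singleton, one_add_one_eq_two]

/-- A vertex of height at most `k` has at most `k` ancestors (itself included) besides the root. -/
lemma exists_ancestors [DecidableEq V] (hv : ∀ x, x ≠ v → h (par x) < h x) (k : ℕ) (x : V)
    (hx : h x ≤ k) :
    ∃ C : Finset V, C.card ≤ k ∧ x ∈ insert v C ∧ ∀ y ∈ C, par y ∈ insert v C := by
  induction k generalizing x with
  | zero =>
    have : x = v := by
      by_contra hxv
      have := hv x hxv
      omega
    exact ⟨∅, by simp, by simp [this], by simp⟩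
  | succ k ih =>
    by_cases hxv : x = v
    · exact ⟨∅, by simp, by simp [hxv], by simp⟩
    · have := hv x hxv
      obtain ⟨C, hC, hxC, hpC⟩ := ih (par x) (by omega)
      refine ⟨insert x C, (Finset.card_insert_le _ _).trans (by omega), by simp, ?_⟩
      intro y hy
      rw [Finset.insert_comm]
      obtain rfl | hy := Finset.mem_insert.1 hy
      · exact Finset.mem_insert_of_mem hxC
      · exact Finset.mem_insert_of_mem (hpC y hy)

/-- Two edges `s(a, b)` and `s(c, e)` that join no vertex to its parent would, together with the
ancestors of their ends, give at most `4 * r + 1` vertices spanning too many edges. -/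
lemma SparseUpTo.eq_of_not_parentGraph_adj {G : SimpleGraph V} {r : ℕ}
    (hG : SparseUpTo (4 * r + 1) G) (hpv : par v = v) (hv : ∀ x, x ≠ v → h (par x) < h x)
    (hr : ∀ x, h x ≤ r) (hadj : ∀ x, x ≠ v → G.Adj x (par x)) {a b c e : V} (hab : G.Adj a b)
    (hce : G.Adj c e) (hab' : ¬ (parentGraph par).Adj a b) (hce' : ¬ (parentGraph par).Adj c e) :
    s(a, b) = s(c, e) := by
  classical
  by_contra hne
  obtain ⟨A, hA, haA, hpA⟩ := exists_ancestors hv r a (hr a)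
  obtain ⟨B, hB, hbB, hpB⟩ := exists_ancestors hv r b (hr b)
  obtain ⟨C, hC, hcC, hpC⟩ := exists_ancestors hv r c (hr c)
  obtain ⟨E, hE, heE, hpE⟩ := exists_ancestors hv r e (hr e)
  set S : Finset V := insert v (A ∪ B ∪ C ∪ E) with hS
  have hcard : S.card ≤ 4 * r + 1 := by
    rw [hS]
    have h1 := Finset.card_insert_le v (A ∪ B ∪ C ∪ E)
    have h2 := Finset.card_union_le (A ∪ B ∪ C) E
    have h3 := Finset.card_union_le (A ∪ B) C
    have h4 := Finset.card_union_le A B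
    omega
  have hpS : ∀ y ∈ S, par y ∈ S := by
    intro y hy
    simp only [hS, Finset.mem_insert, Finset.mem_union] at hy hpA hpB hpC hpE ⊢
    grind
  set F : Finset (Sym2 V) := (S.erase v).image fun x => s(x, par x) with hF
  have hFcard : F.card + 1 = S.card := by
    rw [hF, Finset.card_image_of_injOn, Finset.card_erase_add_one (by simp [hS])]
    intro x hx y hy hxy
    have hx' := hv x (Finset.ne_of_mem_erase hx)
    have hy' := hv y (Finset.ne_of_mem_erase hy)
    obtain ⟨h1, -⟩ | ⟨h1, h2⟩ := Sym2.eq_iff.1 hxy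
    · exact h1
    · rw [h2] at hx'
      rw [← h1] at hy'
      omega
  have hnF : ∀ x y, G.Adj x y → ¬ (parentGraph par).Adj x y → s(x, y) ∉ F := by
    intro x y hxy hn hmem
    obtain ⟨z, -, hz⟩ := Finset.mem_image.1 hmem
    refine hn (parentGraph_adj.2 ⟨hxy.ne, ?_⟩)
    obtain ⟨rfl, h2⟩ | ⟨rfl, h2⟩ := Sym2.eq_iff.1 hz
    · exact Or.inl h2
    · exact Or.inr h2
  have hTcard : (insert s(a, b) (insert s(c, e) F)).card = F.card + 2 := by
    rw [Finset.card_insert_of_notMem, Finset.card_insert_of_notMem (hnF _ _ hce hce')]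
    rw [Finset.mem_insert, not_or]
    exact ⟨hne, hnF _ _ hab hab'⟩
  have := hG S (insert s(a, b) (insert s(c, e) F)) hcard ?_ ?_
  · omega
  · intro f hf
    obtain rfl | hf := Finset.mem_insert.1 hf
    · simp only [Finset.mk_mem_sym2_iff, hS, Finset.mem_insert, Finset.mem_union] at haA hbB ⊢
      grind
    obtain rfl | hf := Finset.mem_insert.1 hf
    · simp only [Finset.mk_mem_sym2_iff, hS, Finset.mem_insert, Finset.mem_union] at hcC heE ⊢
      grind
    obtain ⟨x, hx, rfl⟩ := Finset.mem_image.1 hf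
    have hxS := Finset.mem_of_mem_erase hx
    exact Finset.mk_mem_sym2_iff.2 ⟨hxS, hpS x hxS⟩
  · intro f hf
    obtain rfl | hf := Finset.mem_insert.1 (Finset.mem_coe.1 hf)
    · exact hab
    obtain rfl | hf := Finset.mem_insert.1 hf
    · exact hce
    obtain ⟨x, hx, rfl⟩ := Finset.mem_image.1 hf
    exact hadj x (Finset.ne_of_mem_erase hx)

end Parent

/-- A breadth-first search tree from a centre misses at most one edge. -/
lemma SparseUpTo.treewidth_le_two {V : Type u} [Finite V] {G : SimpleGraph V} {r : ℕ}
    (hG : SparseUpTo (4 * r + 1) G) (hr : G.radius ≤ r) : treewidth G ≤ 2 := by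
  have hne : Nonempty V := by
    by_contra hV
    rw [not_nonempty_iff] at hV
    rw [SimpleGraph.radius_eq_top_of_isEmpty] at hr
    simp at hr
  have hconn : G.Connected := SimpleGraph.radius_ne_top_iff.1 fun h => by simp [h] at hr
  obtain ⟨v, hv⟩ := G.exists_eccent_eq_radius
  have hdist : ∀ x, G.dist v x ≤ r := by
    intro x
    have h1 : G.edist v x ≤ r := SimpleGraph.edist_le_eccent.trans (hv.trans_le hr)
    rw [← (hconn.preconnected v x).coe_dist_eq_edist] at h1
    exact_mod_cast h1
  have hpar : ∀ x, ∃ y, (x = v → y = v) ∧ (x ≠ v → G.dist v y < G.dist v x ∧ G.Adj x y) := by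
    intro x
    by_cases hx : x = v
    · exact ⟨v, by simp [hx]⟩
    obtain ⟨w, hw⟩ := hconn.exists_walk_length_eq_dist x v
    cases w with
    | nil => exact absurd rfl hx
    | @cons _ y _ hxy w =>
      refine ⟨y, by simp [hx], fun _ => ⟨?_, hxy⟩⟩
      have := SimpleGraph.dist_le w
      rw [SimpleGraph.Walk.length_cons] at hw
      rw [G.dist_comm, G.dist_comm (u := v)]
      omega
  choose par hpv hpar using hpar
  have hlt : ∀ x, x ≠ v → G.dist v (par x) < G.dist v x := fun x hx => (hpar x hx).1
  by_cases hex : ∃ a b, G.Adj a b ∧ ¬ (parentGraph par).Adj a b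
  · obtain ⟨a, b, hab, hab'⟩ := hex
    refine treewidth_le_two_of_parent (hpv v rfl) hlt a fun x y hxy => ?_
    by_cases hxy' : (parentGraph par).Adj x y
    · exact Or.inl hxy'
    · have := hG.eq_of_not_parentGraph_adj (hpv v rfl) hlt hdist (fun x hx => (hpar x hx).2)
        hxy hab hxy' hab'
      grind
  · push Not at hex
    exact treewidth_le_two_of_parent (hpv v rfl) hlt v fun x y hxy => Or.inl (hex x y hxy)

lemma SparseUpTo.subgraph_coe {V : Type u} {G : SimpleGraph V} {K : ℕ} (hG : SparseUpTo K G)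
    (H : G.Subgraph) : SparseUpTo K H.coe := by
  intro S T hS hTS hT
  have h := hG (S.map (Function.Embedding.subtype _))
    (T.map (Function.Embedding.subtype _).sym2Map) (by simpa using hS) ?_ ?_
  · simpa using h
  · intro e he
    obtain ⟨f, hf, rfl⟩ := Finset.mem_map.1 he
    have hfS := Finset.mem_sym2_iff.1 (hTS hf)
    refine Finset.mem_sym2_iff.2 fun x hx => ?_
    obtain ⟨y, hy, rfl⟩ := Sym2.mem_map.1 hx
    exact Finset.mem_map_of_mem _ (hfS y hy)
  · intro e he
    obtain ⟨f, hf, rfl⟩ := Finset.mem_map.1 (Finset.mem_coe.1 he)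
    have hfT := hT (Finset.mem_coe.2 hf)
    induction f with
    | _ x y => exact H.adj_sub hfT

/-- The decomposition into a single bag. -/
lemma treewidth_le_card {V : Type u} (G : SimpleGraph V) : treewidth G ≤ ENat.card V := by
  let D : TreeDecomposition G :=
    { Node := PUnit
      finite_node := inferInstance
      tree := ⊥
      isTree := SimpleGraph.IsTree.of_subsingleton
      bag := fun _ => Set.univ
      vertex_mem := fun x => ⟨PUnit.unit, trivial⟩
      edge_mem := fun x y _ => ⟨PUnit.unit, trivial, trivial⟩
      connected := fun x => SimpleGraph.Preconnected.of_subsingleton }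
  refine (iInf_le _ D).trans (tsub_le_self.trans (iSup_le fun t => ?_))
  exact (Set.encard_univ V).le

/-! ### Shallow topological minors of sparse graphs -/

/-- The subdivision of `K₄` formed by the paths of a shallow topological minor has two more edges
than vertices, and at most `12 * r + 4` vertices. -/
lemma SparseUpTo.cliqueFree_four {W : Type u} {V : Type v} {r : ℕ} {M : SimpleGraph W}
    {G : SimpleGraph V} (hG : SparseUpTo (12 * r + 4) G) (hM : IsShallowTopologicalMinor r M G) :
    M.CliqueFree 4 := by
  classical
  by_contra hK
  let f := SimpleGraph.topEmbeddingOfNotCliqueFree hK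
  obtain ⟨nail, path, hpath, -, hnail, hdisj⟩ := hM
  -- the six edges of `K₄`
  let I := {x : Fin 4 × Fin 4 // x.1 < x.2}
  have hIcard : Fintype.card I = 6 := by decide
  have hadj : ∀ i : I, M.Adj (f i.1.1) (f i.1.2) := fun i => f.map_adj_iff.2 i.2.ne
  let P : ∀ i : I, G.Walk (nail (f i.1.1)) (nail (f i.1.2)) := fun i => path _ _ (hadj i)
  let N : Finset V := Finset.univ.image fun i : Fin 4 => nail (f i)
  have hNcard : N.card ≤ 4 := Finset.card_image_le
  have hNmem : ∀ i, nail (f i) ∈ N := fun i => Finset.mem_image_of_mem _ (Finset.mem_univ i)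
  let S : Finset V := N ∪ Finset.univ.biUnion fun i => (P i).support.toFinset \ N
  let T : Finset (Sym2 V) := Finset.univ.biUnion fun i => (P i).edges.toFinset
  have hint : ∀ i, ((P i).support.toFinset \ N).card + 1 ≤ (P i).length := by
    intro i
    have hne : nail (f i.1.1) ≠ nail (f i.1.2) := nail.injective.ne (hadj i).ne
    have hsub : ((P i).support.toFinset \ N) ∪ {nail (f i.1.1), nail (f i.1.2)} ⊆
        (P i).support.toFinset := by
      intro x hx
      simp only [Finset.mem_union, Finset.mem_sdiff, List.mem_toFinset, Finset.mem_insert,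
        Finset.mem_singleton] at hx ⊢
      obtain hx | rfl | rfl := hx
      · exact hx.1
      · exact (P i).start_mem_support
      · exact (P i).end_mem_support
    have hdis : Disjoint ((P i).support.toFinset \ N) {nail (f i.1.1), nail (f i.1.2)} := by
      refine Finset.disjoint_left.2 fun x hx hx' => (Finset.mem_sdiff.1 hx).2 ?_
      obtain rfl | hx' := Finset.mem_insert.1 hx'
      · exact hNmem _
      · rw [Finset.mem_singleton.1 hx']
        exact hNmem _
    have h1 := Finset.card_le_card hsub
    rw [Finset.card_union_of_disjoint hdis, Finset.card_pair hne,
      List.toFinset_card_of_nodup (hpath _ _ (hadj i)).1.support_nodup,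
      SimpleGraph.Walk.length_support] at h1
    change _ + 2 ≤ (P i).length + 1 at h1
    omega
  have hlen : ∀ i, (P i).length ≤ 2 * r + 1 := fun i => (hpath _ _ (hadj i)).2
  have hS₀ : S.card ≤ N.card + ∑ i, ((P i).support.toFinset \ N).card :=
    (Finset.card_union_le _ _).trans (Nat.add_le_add_left Finset.card_biUnion_le _)
  have hS : S.card + 2 ≤ ∑ i, (P i).length := by
    have h2 := Finset.sum_le_sum fun i (_ : i ∈ Finset.univ) => hint i
    rw [Finset.sum_add_distrib, Finset.sum_const, Finset.card_univ, hIcard, smul_eq_mul] at h2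
    omega
  have hS' : S.card ≤ 12 * r + 4 := by
    have h2 := Finset.sum_le_sum fun i (_ : i ∈ Finset.univ) =>
      Nat.le_of_succ_le_succ ((hint i).trans (hlen i))
    rw [Finset.sum_const, Finset.card_univ, hIcard, smul_eq_mul] at h2
    omega
  have hsupp : ∀ i, ∀ x ∈ (P i).support, x ∈ S := by
    intro i x hx
    by_cases hxN : x ∈ N
    · exact Finset.mem_union_left _ hxN
    · exact Finset.mem_union_right _ (Finset.mem_biUnion.2 ⟨i, Finset.mem_univ i,
        Finset.mem_sdiff.2 ⟨List.mem_toFinset.2 hx, hxN⟩⟩)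
  have hT : T.card = ∑ i, (P i).length := by
    have hcard : ∀ i, (P i).edges.toFinset.card = (P i).length := fun i => by
      rw [List.toFinset_card_of_nodup (hpath _ _ (hadj i)).1.isTrail.edges_nodup,
        SimpleGraph.Walk.length_edges]
    rw [Finset.card_biUnion, Finset.sum_congr rfl fun i _ => hcard i]
    intro i _ j _ hij
    refine Finset.disjoint_left.2 fun e hei hej => ?_
    rw [List.mem_toFinset] at hei hej
    have hijs : s(f i.1.1, f i.1.2) ≠ s(f j.1.1, f j.1.2) := by
      intro he
      obtain ⟨⟨a, b⟩, hab⟩ := i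
      obtain ⟨⟨c, d⟩, hcd⟩ := j
      obtain ⟨h1, h2⟩ | ⟨h1, h2⟩ := Sym2.eq_iff.1 he
      · exact hij (Subtype.ext (Prod.ext (f.injective h1) (f.injective h2)))
      · have h1 := f.injective h1
        have h2 := f.injective h2
        dsimp only at h1 h2 hab hcd
        omega
    induction e with
    | _ x y =>
      have hxy : x ≠ y := ((P i).adj_of_mem_edges hei).ne
      have hxi := (P i).fst_mem_support_of_mem_edges hei
      have hyi := (P i).snd_mem_support_of_mem_edges hei
      have hxj := (P j).fst_mem_support_of_mem_edges hej
      have hyj := (P j).snd_mem_support_of_mem_edges hej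
      -- the ends of a common edge are nails, so they are the ends of both paths
      obtain ⟨a, rfl⟩ := hdisj _ _ (hadj i) _ _ (hadj j) hijs x hxi hxj
      obtain ⟨b, rfl⟩ := hdisj _ _ (hadj i) _ _ (hadj j) hijs y hyi hyj
      have hab : a ≠ b := fun h => hxy (by rw [h])
      have h1 := hnail _ _ (hadj i) a hxi
      have h2 := hnail _ _ (hadj i) b hyi
      have h3 := hnail _ _ (hadj j) a hxj
      have h4 := hnail _ _ (hadj j) b hyj
      exact hijs (((Sym2.mem_and_mem_iff hab).1 ⟨Sym2.mem_iff.2 h1, Sym2.mem_iff.2 h2⟩).trans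
        ((Sym2.mem_and_mem_iff hab).1 ⟨Sym2.mem_iff.2 h3, Sym2.mem_iff.2 h4⟩).symm)
  have := hG S T hS' ?_ ?_
  · omega
  · intro e he
    obtain ⟨i, -, hi⟩ := Finset.mem_biUnion.1 he
    rw [List.mem_toFinset] at hi
    induction e with
    | _ x y =>
      exact Finset.mk_mem_sym2_iff.2 ⟨hsupp i x ((P i).fst_mem_support_of_mem_edges hi),
        hsupp i y ((P i).snd_mem_support_of_mem_edges hi)⟩
  · intro e he
    obtain ⟨i, -, hi⟩ := Finset.mem_biUnion.1 (Finset.mem_coe.1 he)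
    exact (P i).edges_subset_edgeSet (List.mem_toFinset.1 hi)

lemma cliqueNum_lt_of_cliqueFree {W : Type u} {M : SimpleGraph W} {k : ℕ}
    (h : M.CliqueFree k) : M.cliqueNum < k := by
  by_contra! hk
  obtain ⟨s, hs⟩ := M.exists_isNClique_cliqueNum
  exact (h.mono hk) s hs

lemma SparseUpTo.shallowCliqueNum_le {V : Type u} {r : ℕ} {G : SimpleGraph V}
    (hG : SparseUpTo (12 * r + 4) G) : shallowCliqueNum r G ≤ 3 := by
  refine iSup_le fun m => iSup_le fun M => iSup_le fun hM => ?_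
  exact_mod_cast Nat.le_of_lt_succ (cliqueNum_lt_of_cliqueFree (hG.cliqueFree_four hM))

lemma shallowCliqueNum_le_card {V : Type u} [Finite V] (r : ℕ) (G : SimpleGraph V) :
    shallowCliqueNum r G ≤ (Nat.card V : ℕ∞) := by
  refine iSup_le fun m => iSup_le fun M => iSup_le fun ⟨nail, _⟩ => ?_
  have h1 : Nat.card (Fin m) ≤ Nat.card V := Nat.card_le_card_of_injective nail nail.injective
  obtain ⟨s, hs⟩ := M.exists_isNClique_cliqueNum
  have h2 := Finset.card_le_univ s
  rw [hs.card_eq] at h2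
  rw [Nat.card_eq_fintype_card] at h1
  exact_mod_cast h2.trans h1

end RandomSparse

theorem theorem2 (d : ℕ → ℝ) (hd : RandomSparse.IsSubpolynomial d) :
    RandomSparse.AsymptoticallyAlmostSurely d RandomSparse.LocallyBoundedTreewidth ∧
      RandomSparse.AsymptoticallyAlmostSurely d RandomSparse.NowhereDense := by
  obtain ⟨κ, hκ, hprob⟩ := RandomSparse.exists_sparse_class hd
  -- From `N r` on, the graphs of the class are sparse enough for both arguments; graphs on at most
  -- `N r` vertices have treewidth and clique numbers at most `N r`.
  have hN : ∀ r : ℕ, ∃ N, ∀ n ≥ N, 12 * r + 4 ≤ κ n := fun r =>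
    eventually_atTop.1 (hκ.eventually_ge_atTop (12 * r + 4))
  choose N hN using hN
  refine ⟨⟨_, ⟨fun r => max 2 (N r), ?_⟩, hprob⟩, ⟨_, ⟨fun r => max 3 (N r) + 1, ?_⟩, hprob⟩⟩
  · intro r n G hG H hr
    have hG : RandomSparse.SparseUpTo (κ n) G := hG
    obtain hn | hn := le_total (N r) n
    · refine (((hG.mono ?_).subgraph_coe H).treewidth_le_two hr).trans ?_
      · have := hN r n hn
        omega
      · exact_mod_cast le_max_left 2 (N r)
    · refine (RandomSparse.treewidth_le_card _).trans ?_
      have h1 : Nat.card H.verts ≤ n := by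
        simpa using Nat.card_le_card_of_injective _ (Subtype.val_injective (p := (· ∈ H.verts)))
      rw [ENat.card_eq_coe_natCard]
      exact_mod_cast h1.trans (hn.trans (le_max_right _ _))
  · intro r n G hG
    have hG : RandomSparse.SparseUpTo (κ n) G := hG
    have h : RandomSparse.shallowCliqueNum r G ≤ ((max 3 (N r) : ℕ) : ℕ∞) := by
      obtain hn | hn := le_total (N r) n
      · refine (hG.mono (hN r n hn)).shallowCliqueNum_le.trans ?_
        exact_mod_cast le_max_left 3 (N r)
      · refine (RandomSparse.shallowCliqueNum_le_card r G).trans ?_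
        rw [Nat.card_eq_fintype_card, Fintype.card_fin]
        exact_mod_cast hn.trans (le_max_right _ _)
    refine h.trans_lt ?_
    exact_mod_cast Nat.lt_succ_self _
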